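/- A \emph{sequential machine} is a system $M=(Q,\Sigma,\Gamma,\delta)$ with finite sets $Q$ (states), $\Sigma$ (input symbols), $\Gamma$ (output symbols) and a move function $\delta:Q\times\Sigma\to Q\times\Gamma$; here $Q\neq\emptyset$. It is a \emph{reversible sequential machine} (RSM) if $\delta$ is injective, and an RSM with $|Q|=n$ and $|\Sigma|=|\Gamma|=k$ is called an $n$-state $k$-symbol \emph{reversible logic element with memory} (RLEM). Two machines are \emph{equivalent} if one is obtained from the other by renaming the states, the input symbols and the output symbols. A $k$-symbol RLEM is \emph{degenerate} if (i) it is equivalent to simple connecting wires, i.e. for every initial state $q$ there is a map $f:\Sigma\to\Gamma$ such that on every input word $a_1\cdots a_l$ the machine, started in $q$, outputs $f(a_1)\cdots f(a_l)$; or (ii) for some $k'<k$ it is equivalent to a $k'$-symbol RLEM supplemented with $k-k'$ plain wires (a symbol on a wire is passed on unchanged, independently of the state and without changing it). Otherwise it is \emph{non-degenerate}. A \emph{circuit} with external input ports $A$ and external output ports $B$ composed of $m$ copies of an RLEM with input symbols $\Sigma$ and output symbols $\Gamma$ is given by an injective connection function $A\sqcup(\{1,\dots,m\}\times\Gamma)\to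 B\sqcup(\{1,\dots,m\}\times\Sigma)$ (no fan-out, no merging of lines). A single signal given to an external input follows the connections and passes through the copies it meets according to their current states and the move function, changing these states, until it leaves through an external output. The circuit \emph{realizes} an RSM $N=(P,A,B,\delta_N)$ if the states of $N$ can be represented by distinct assignments $e(p)$ $(p\in P)$ of states to the $m$ copies such that, whenever $\delta_N(p,a)=(p',b)$, a signal given to the input $a$ of the circuit in the state $e(p)$ eventually leaves through the output $b$, with the circuit then in the state $e(p')$. An RLEM is \emph{universal} if every RSM is realized by a circuit composed only of finitely many copies of the RLEM. \textbf{Theorem.} Every non-degenerate 2-state $k$-symbol RLEM with $k>2$ is universal. -/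

import Mathlib

/-- A sequential machine (of Mealy type) with state set `Q`, input alphabet `S` and output
alphabet `G`, given by its move function.  Finiteness of the three sets is assumed separately. -/
structure SequentialMachine (Q S G : Type*) where
  /-- The move function: `move q a = (q', g)` means that in state `q`, on the input symbol `a`,
  the machine goes to state `q'` and outputs the symbol `g`. -/
  move : Q → S → Q × G

namespace SequentialMachine

/-- A sequential machine is reversible if its move function is injective on `Q × S`. -/
def IsReversible {Q S G : Type*} (M : SequentialMachine Q S G) : Prop :=
  Function.Injective (fun p : Q × S => M.move p.1 p.2)

/-- `M` is an `n`-state `k`-symbol reversible logic element with memory: a reversible sequential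
machine with `n` states and with `k` input symbols and `k` output symbols. -/
structure IsRLEM {Q S G : Type*} (M : SequentialMachine Q S G) (n k : ℕ) : Prop where
  finite_states : Finite Q
  finite_inputs : Finite S
  finite_outputs : Finite G
  card_states : Nat.card Q = n
  card_inputs : Nat.card S = k
  card_outputs : Nat.card G = k
  reversible : M.IsReversible

/-- Two machines are equivalent if one is obtained from the other by renaming the states, the
input symbols and the output symbols. -/
def IsEquivalent {Q S G Q' S' G' : Type*} (M : SequentialMachine Q S G)
    (N : SequentialMachine Q' S' G') : Prop :=
  ∃ (eQ : Q ≃ Q') (eS : S ≃ S') (eG : G ≃ G'), ∀ q a,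
    N.move (eQ q) (eS a) = (eQ (M.move q a).1, eG (M.move q a).2)

/-- The output word produced by `M`, started in state `q`, on an input word. -/
def outputs {Q S G : Type*} (M : SequentialMachine Q S G) : Q → List S → List G
  | _, [] => []
  | q, a :: w => (M.move q a).2 :: M.outputs (M.move q a).1 w

/-- `M` is equivalent to simple connecting wires: from whichever state it is started, it behaves
like a fixed wiring `f` of the input ports to the output ports. -/
def ActsAsWires {Q S G : Type*} (M : SequentialMachine Q S G) : Prop :=
  ∀ q, ∃ f : S → G, ∀ w : List S, M.outputs q w = w.map f

/-- The machine `N` with additional plain wires, indexed by `W`: a signal on a wire passes through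
without consulting or changing the state. -/
def withWires {Q S G : Type*} (N : SequentialMachine Q S G) (W : Type*) :
    SequentialMachine Q (S ⊕ W) (G ⊕ W) where
  move q
    | Sum.inl a => ((N.move q a).1, Sum.inl (N.move q a).2)
    | Sum.inr w => (q, Sum.inr w)

/-- A `k`-symbol RLEM `M` with `n` states is degenerate if it is equivalent to simple connecting
wires, or to an RLEM with only `k' < k` symbols (the other `k - k'` symbols being plain wires). -/
def IsDegenerate {Q S G : Type*} (M : SequentialMachine Q S G) (n k : ℕ) : Prop :=
  M.ActsAsWires ∨
    ∃ k' < k, ∃ N : SequentialMachine (Fin n) (Fin k') (Fin k'),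
      N.IsRLEM n k' ∧ M.IsEquivalent (N.withWires (Fin (k - k')))

end SequentialMachine

/-- A circuit with external input ports `A` and external output ports `B`, composed of `m` copies
of an element with input ports `S` and output ports `G`.  The connection function joins every
external input and every output port of a copy to an external output or an input port of a copy.
It is a function (no fan-out) and it is injective (lines do not merge). -/
structure ElementCircuit (m : ℕ) (S G A B : Type*) where
  conn : A ⊕ (Fin m × G) → B ⊕ (Fin m × S)
  conn_injective : Function.Injective conn

namespace ElementCircuit

/-- `C.Travels M σ v τ b`: when the `m` copies of `M` are in the states `σ` and the (only) signal
has arrived at the port `v`, it travels on through the circuit and finally leaves through the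
external output `b`, with the copies then in the states `τ`. -/
inductive Travels {m : ℕ} {Q S G A B : Type*} (C : ElementCircuit m S G A B)
    (M : SequentialMachine Q S G) :
    (Fin m → Q) → B ⊕ (Fin m × S) → (Fin m → Q) → B → Prop
  | leave (σ : Fin m → Q) (b : B) : Travels C M σ (Sum.inl b) σ b
  | pass (σ : Fin m → Q) (i : Fin m) (x : S) (τ : Fin m → Q) (b : B)
      (h : Travels C M (Function.update σ i (M.move (σ i) x).1)
        (C.conn (Sum.inr (i, (M.move (σ i) x).2))) τ b) :
      Travels C M σ (Sum.inr (i, x)) τ b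

/-- The circuit `C`, composed of copies of `M`, realizes the machine `N`: the states of `N` are
represented by distinct states of the circuit, and whenever `N` moves from `p` to `p'` on the
input `a` with the output `b`, a signal given to the external input `a` of the circuit in the
state that represents `p` leaves through the external output `b`, with the circuit then in the
state that represents `p'`. -/
def Realizes {m : ℕ} {Q S G P A B : Type*} (C : ElementCircuit m S G A B)
    (M : SequentialMachine Q S G) (N : SequentialMachine P A B) : Prop :=
  ∃ enc : P → (Fin m → Q), Function.Injective enc ∧
    ∀ p a, C.Travels M (enc p) (C.conn (Sum.inl a)) (enc (N.move p a).1) (N.move p a).2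

end ElementCircuit

/-- `M` is universal: every reversible sequential machine (with finite sets of states, input and
output symbols, and at least one state) is realized by a circuit composed only of copies of `M`. -/
def SequentialMachine.IsUniversal {Q S G : Type*} (M : SequentialMachine Q S G) : Prop :=
  ∀ (P A B : Type) [Finite P] [Nonempty P] [Finite A] [Finite B] (N : SequentialMachine P A B),
    N.IsReversible → ∃ (m : ℕ) (C : ElementCircuit m S G A B), C.Realizes M N

/-!
The proof works with *partial machines*, deterministic transition systems some of whose moves are
left unspecified.  A partial machine `S` simulates `T` if, after some inputs and outputs of `S` are
joined by lines that do not merge, all specified moves of `T` are performed.  Simulation is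
transitive and compatible with putting devices side by side, so it is enough to go on from element
to element in small steps, each of which uses at most three devices.

*Upwards.*  Two elements with two states and two symbols suffice for everything: the reading toggle,
whose inputs report the state and possibly flip it, and its inverse, which overwrites the state and
reports whether it has changed.  They give an element `mergeSplit` with three symbols, which merges
two lines while remembering where the signal came from; three of these give a `latch`, and two
latches holding the same bit give a row of a `bank`.  A bank records the port through which a signal
enters, lets the signal visit some device on a common line, and sends it back to the recorded port,
on one of two lines according to the direction from which the signal returns.  Hence a one-bit
memory cell can be shared by arbitrarily many ports (`sharedCell`).  One shared cell for each state
of a reversible machine `N`, of which exactly one is set, turns an input signal into a signal on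
a line that determines state and input; this line is led to the port that sets the cell of the new
state and emits the output (`cellRow_simulates_reversible`).  Lines do not merge since `N` is
reversible.

*Downwards.*  A non-degenerate machine with two states is `IsEssential`: no symbol is a plain wire,
some move changes the state, and some symbol has an output depending on the state.  As long as there
are more than two symbols, joining one suitable output to one suitable input leaves an essential
machine with one symbol less (`IsEssential.exists_feedback`).  This reduces the theorem to three
symbols, a finite problem: up to renaming, one more feedback line yields the reading toggle, and
also its inverse, but for three exceptional machines in each case, and for these two or three copies
are sufficient.
-/

open Function

/-! ### Partial machines, wirings and simulation -/

/-- A partial machine: a deterministic transition system with ports, some of whose moves may be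
left unspecified (`none`).  Partial machines serve as specifications: whatever happens on an
unspecified move is irrelevant. -/
abbrev PartialMachine (P A B : Type*) := P → A → Option (P × B)

/-- A sequential machine regarded as a partial machine all of whose moves are specified. -/
def SequentialMachine.toPartial {Q S G : Type*} (M : SequentialMachine Q S G) :
    PartialMachine Q S G := fun q a => some (M.move q a)

namespace PartialMachine

/-- A wiring around a device with input ports `A` and output ports `B`, offering to the outside
the input ports `A'` and the output ports `B'`.  Every outer input leads to an inner input; an
inner output leads to an outer output, back to an inner input, or is left open (`none`).
Lines do not merge. -/
structure Wiring (A B A' B' : Type*) where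
  inp : A' → A
  out : B → Option (B' ⊕ A)
  inp_injective : Injective inp
  out_injective : ∀ x y t, out x = some t → out y = some t → x = y
  out_ne_inp : ∀ x a, out x ≠ some (Sum.inr (inp a))

/-- `Route S W p a q b`: a signal at the inner input `a` of `S` in the state `p` leaves the wired
device through the outer output `b`, with `S` then in the state `q`. -/
inductive Route {P A B A' B' : Type*} (S : PartialMachine P A B) (W : Wiring A B A' B') :
    P → A → P → B' → Prop
  | exit {p a q b b'} (h : S p a = some (q, b)) (hb : W.out b = some (Sum.inl b')) :
      Route S W p a q b'
  | loop {p a q b a₁ r b'} (h : S p a = some (q, b)) (hb : W.out b = some (Sum.inr a₁))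
      (hr : Route S W q a₁ r b') : Route S W p a r b'

/-- `S` simulates `T`: for some wiring around `S` and some representation of the states of `T` by
distinct states of `S`, all specified moves of `T` are performed. -/
def Simulates {P A B P' A' B' : Type*} (S : PartialMachine P A B)
    (T : PartialMachine P' A' B') : Prop :=
  ∃ (W : Wiring A B A' B') (enc : P' → P), Injective enc ∧
    ∀ p a q b, T p a = some (q, b) → Route S W (enc p) (W.inp a) (enc q) b

/-- Follow a signal through the wired device for at most `n` passages. -/
def run {P A B B' : Type*} (S : PartialMachine P A B) (out : B → Option (B' ⊕ A)) :
    ℕ → P → A → Option (P × B')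
  | 0, _, _ => none
  | n + 1, p, a =>
    match S p a with
    | none => none
    | some (q, b) =>
      match out b with
      | none => none
      | some (Sum.inl b') => some (q, b')
      | some (Sum.inr a₁) => run S out n q a₁

theorem Route.of_run {P A B A' B' : Type*} {S : PartialMachine P A B} {W : Wiring A B A' B'}
    (n : ℕ) : ∀ {p a q b}, run S W.out n p a = some (q, b) → Route S W p a q b := by
  induction n with
  | zero => intro p a q b h; simp [run] at h
  | succ n ih =>
    intro p a q b h
    rw [run] at h
    split at h
    · simp at h
    · rename_i q₁ b₁ h₁
      split at h
      · simp at h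
      · rename_i b' hb
        obtain ⟨rfl, rfl⟩ : q₁ = q ∧ b' = b := by simpa using h
        exact .exit h₁ hb
      · rename_i a₁ hb
        exact .loop h₁ hb (ih h)

/-- A concrete simulation can be verified by following all specified moves. -/
theorem Simulates.of_run {P A B P' A' B' : Type*} {S : PartialMachine P A B}
    {T : PartialMachine P' A' B'} (W : Wiring A B A' B') (enc : P' → P) (n : ℕ)
    (henc : Injective enc)
    (h : ∀ p a, ∀ t ∈ T p a, run S W.out n (enc p) (W.inp a) = some (enc t.1, t.2)) :
    S.Simulates T :=
  ⟨W, enc, henc, fun p a q b hT => .of_run n (h p a (q, b) hT)⟩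

theorem Simulates.refl {P A B : Type*} (S : PartialMachine P A B) : S.Simulates S :=
  .of_run ⟨id, fun b => some (Sum.inl b), injective_id, by simp, by simp⟩ id 1 injective_id
    (by rintro p a ⟨q, b⟩ h
        simp only [Option.mem_def] at h
        simp [run, h])

/-- A wiring around a wired device. -/
def Wiring.comp {A B A' B' A'' B'' : Type*} (V : Wiring A B A' B') (W : Wiring A' B' A'' B'') :
    Wiring A B A'' B'' where
  inp a := V.inp (W.inp a)
  out b := (V.out b).bind (Sum.elim
    (fun b' => (W.out b').map (Sum.map id V.inp)) (fun a => some (Sum.inr a)))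
  inp_injective := V.inp_injective.comp W.inp_injective
  out_injective := by
    intro x y t hx hy
    rw [Option.bind_eq_some_iff] at hx hy
    obtain ⟨u, hu, hx⟩ := hx
    obtain ⟨v, hv, hy⟩ := hy
    rcases u with u | u <;> rcases v with v | v
    · simp only [Sum.elim_inl, Option.map_eq_some_iff] at hx hy
      obtain ⟨c, hc, rfl⟩ := hx
      obtain ⟨d, hd, e⟩ := hy
      have hinj : Injective (Sum.map (id : B'' → B'') V.inp) :=
        Sum.map_injective.2 ⟨injective_id, V.inp_injective⟩
      obtain rfl := hinj e
      obtain rfl := W.out_injective _ _ _ hc hd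
      exact V.out_injective _ _ _ hu hv
    · simp only [Sum.elim_inl, Sum.elim_inr, Option.map_eq_some_iff, Option.some.injEq] at hx hy
      obtain ⟨c, hc, rfl⟩ := hx
      rcases c with c | c
      · simp at hy
      · simp only [Sum.map_inr, Sum.inr.injEq] at hy
        exact absurd (hy ▸ hv) (V.out_ne_inp _ _)
    · simp only [Sum.elim_inl, Sum.elim_inr, Option.map_eq_some_iff, Option.some.injEq] at hx hy
      obtain ⟨c, hc, rfl⟩ := hy
      rcases c with c | c
      · simp at hx
      · simp only [Sum.map_inr, Sum.inr.injEq] at hx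
        exact absurd (hx ▸ hu) (V.out_ne_inp _ _)
    · simp only [Sum.elim_inr, Option.some.injEq] at hx hy
      subst hx
      obtain rfl : u = v := by simpa using hy.symm
      exact V.out_injective _ _ _ hu hv
  out_ne_inp := by
    intro x a h
    rw [Option.bind_eq_some_iff] at h
    obtain ⟨u, hu, h⟩ := h
    rcases u with u | u
    · simp only [Sum.elim_inl, Option.map_eq_some_iff] at h
      obtain ⟨c, hc, e⟩ := h
      rcases c with c | c
      · simp at e
      · simp only [Sum.map_inr, Sum.inr.injEq] at e
        exact W.out_ne_inp _ _ (V.inp_injective e ▸ hc)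
    · simp only [Sum.elim_inr, Option.some.injEq, Sum.inr.injEq] at h
      exact V.out_ne_inp _ _ (h ▸ hu)

/-- A simulation of a simulation is a simulation. -/
theorem Simulates.trans {P A B P' A' B' P'' A'' B'' : Type*} {S : PartialMachine P A B}
    {T : PartialMachine P' A' B'} {U : PartialMachine P'' A'' B''}
    (h₁ : S.Simulates T) (h₂ : T.Simulates U) : S.Simulates U := by
  obtain ⟨V, e, he, hV⟩ := h₁
  obtain ⟨W, d, hd, hW⟩ := h₂
  refine ⟨V.comp W, e ∘ d, he.comp hd, fun p a q b hU => ?_⟩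
  -- a passage through the device simulating `T`, continued by one step of the outer wiring
  have exit : ∀ {p a q b c}, Route S V p a q b → W.out b = some (Sum.inl c) →
      Route S (V.comp W) p a q c := by
    intro p a q b c h hc
    induction h with
    | exit h hb => exact .exit h (by simp [Wiring.comp, hb, hc])
    | loop h hb _ ih => exact .loop h (by simp [Wiring.comp, hb]) (ih hc)
  have loop : ∀ {p a q b a₁ r c}, Route S V p a q b → W.out b = some (Sum.inr a₁) →
      Route S (V.comp W) q (V.inp a₁) r c → Route S (V.comp W) p a r c := by
    intro p a q b a₁ r c h ha hr
    induction h with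
    | exit h hb => exact .loop h (by simp [Wiring.comp, hb, ha]) hr
    | loop h hb _ ih => exact .loop h (by simp [Wiring.comp, hb]) (ih ha hr)
  have key : ∀ {p a q b}, Route T W p a q b →
      Route S (V.comp W) (e p) (V.inp a) (e q) b := by
    intro p a q b h
    induction h with
    | exit h hb => exact exit (hV _ _ _ _ h) hb
    | loop h hb _ ih => exact loop (hV _ _ _ _ h) hb ih
  exact key (hW _ _ _ _ hU)

/-- Two partial machines side by side. -/
def par {P A B P' A' B' : Type*} (S : PartialMachine P A B) (T : PartialMachine P' A' B') :
    PartialMachine (P × P') (A ⊕ A') (B ⊕ B')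
  | p, Sum.inl a => (S p.1 a).map fun t => ((t.1, p.2), Sum.inl t.2)
  | p, Sum.inr a => (T p.2 a).map fun t => ((p.1, t.1), Sum.inr t.2)

/-- Two wired devices side by side. -/
def Wiring.par {A B A' B' C D C' D' : Type*} (V : Wiring A B A' B') (W : Wiring C D C' D') :
    Wiring (A ⊕ C) (B ⊕ D) (A' ⊕ C') (B' ⊕ D') where
  inp := Sum.map V.inp W.inp
  out := Sum.elim (fun b => (V.out b).map (Sum.map Sum.inl Sum.inl))
    (fun b => (W.out b).map (Sum.map Sum.inr Sum.inr))
  inp_injective := Sum.map_injective.2 ⟨V.inp_injective, W.inp_injective⟩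
  out_injective := by
    have hl : Injective (Sum.map Sum.inl Sum.inl : B' ⊕ A → (B' ⊕ D') ⊕ (A ⊕ C)) :=
      Sum.map_injective.2 ⟨Sum.inl_injective, Sum.inl_injective⟩
    have hr : Injective (Sum.map Sum.inr Sum.inr : D' ⊕ C → (B' ⊕ D') ⊕ (A ⊕ C)) :=
      Sum.map_injective.2 ⟨Sum.inr_injective, Sum.inr_injective⟩
    rintro (x | x) (y | y) t hx hy
    · simp only [Sum.elim_inl, Option.map_eq_some_iff] at hx hy
      obtain ⟨u, hu, rfl⟩ := hx
      obtain ⟨v, hv, e⟩ := hy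
      obtain rfl := hl e
      rw [V.out_injective _ _ _ hu hv]
    · simp only [Sum.elim_inl, Sum.elim_inr, Option.map_eq_some_iff] at hx hy
      obtain ⟨u, hu, rfl⟩ := hx
      obtain ⟨v, hv, e⟩ := hy
      rcases u with u | u <;> rcases v with v | v <;> simp at e
    · simp only [Sum.elim_inl, Sum.elim_inr, Option.map_eq_some_iff] at hx hy
      obtain ⟨u, hu, rfl⟩ := hx
      obtain ⟨v, hv, e⟩ := hy
      rcases u with u | u <;> rcases v with v | v <;> simp at e
    · simp only [Sum.elim_inr, Option.map_eq_some_iff] at hx hy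
      obtain ⟨u, hu, rfl⟩ := hx
      obtain ⟨v, hv, e⟩ := hy
      obtain rfl := hr e
      rw [W.out_injective _ _ _ hu hv]
  out_ne_inp := by
    rintro (x | x) (a | a) h <;>
    · simp only [Sum.elim_inl, Sum.elim_inr, Option.map_eq_some_iff] at h
      obtain ⟨u, hu, e⟩ := h
      rcases u with u | u <;> simp at e <;> subst e <;>
      first
        | exact V.out_ne_inp _ _ hu
        | exact W.out_ne_inp _ _ hu

theorem Simulates.par {P₁ A₁ B₁ P₂ A₂ B₂ P₃ A₃ B₃ P₄ A₄ B₄ : Type*}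
    {S₁ : PartialMachine P₁ A₁ B₁} {S₂ : PartialMachine P₂ A₂ B₂}
    {T₁ : PartialMachine P₃ A₃ B₃} {T₂ : PartialMachine P₄ A₄ B₄}
    (h₁ : S₁.Simulates T₁) (h₂ : S₂.Simulates T₂) : (S₁.par S₂).Simulates (T₁.par T₂) := by
  obtain ⟨V, e, he, hV⟩ := h₁
  obtain ⟨W, d, hd, hW⟩ := h₂
  have left : ∀ {p a q b} (x : P₂), Route S₁ V p a q b →
      Route (S₁.par S₂) (V.par W) (p, x) (Sum.inl a) (q, x) (Sum.inl b) := by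
    intro p a q b x h
    induction h with
    | exit h hb =>
      exact .exit (b := Sum.inl _) (by simp only [PartialMachine.par, h]; rfl)
        (by simp [Wiring.par, hb])
    | loop h hb _ ih =>
      exact .loop (b := Sum.inl _) (by simp only [PartialMachine.par, h]; rfl)
        (by simp only [Wiring.par, hb, Sum.elim_inl]; rfl) ih
  have right : ∀ {p a q b} (x : P₁), Route S₂ W p a q b →
      Route (S₁.par S₂) (V.par W) (x, p) (Sum.inr a) (x, q) (Sum.inr b) := by
    intro p a q b x h
    induction h with
    | exit h hb =>
      exact .exit (b := Sum.inr _) (by simp only [PartialMachine.par, h]; rfl)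
        (by simp [Wiring.par, hb])
    | loop h hb _ ih =>
      exact .loop (b := Sum.inr _) (by simp only [PartialMachine.par, h]; rfl)
        (by simp only [Wiring.par, hb, Sum.elim_inr]; rfl) ih
  refine ⟨V.par W, Prod.map e d, he.prodMap hd, ?_⟩
  rintro ⟨p, x⟩ (a | a) ⟨q, y⟩ b h
  · simp only [PartialMachine.par, Option.map_eq_some_iff, Prod.exists] at h
    obtain ⟨q', b', h, e⟩ := h
    simp only [Prod.mk.injEq] at e
    obtain ⟨⟨rfl, rfl⟩, rfl⟩ := e
    exact left _ (hV _ _ _ _ h)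
  · simp only [PartialMachine.par, Option.map_eq_some_iff, Prod.exists] at h
    obtain ⟨q', b', h, e⟩ := h
    simp only [Prod.mk.injEq] at e
    obtain ⟨⟨rfl, rfl⟩, rfl⟩ := e
    exact right _ (hW _ _ _ _ h)

/-- Copies of a partial machine, indexed by `K`, side by side. -/
def pow {P A B : Type*} (S : PartialMachine P A B) (K : Type*) [DecidableEq K] :
    PartialMachine (K → P) (K × A) (K × B) :=
  fun σ x => (S (σ x.1) x.2).map fun t => (update σ x.1 t.1, (x.1, t.2))

/-- Copies indexed by a disjoint union can be used as two separate groups of copies. -/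
theorem pow_simulates_par {P A B J K L : Type*} [DecidableEq J] [DecidableEq K] [DecidableEq L]
    (S : PartialMachine P A B) (f : K ⊕ L ≃ J) :
    (S.pow J).Simulates ((S.pow K).par (S.pow L)) := by
  have upl : ∀ (σ : K → P) (τ : L → P) (i : K) (q : P),
      update (Sum.elim σ τ ∘ f.symm) (f (Sum.inl i)) q =
        Sum.elim (update σ i q) τ ∘ f.symm := by
    intro σ τ i q
    ext j
    obtain ⟨j, rfl⟩ := f.surjective j
    rcases j with j | j <;>
      simp only [comp_apply, Equiv.symm_apply_apply, update_apply, f.injective.eq_iff,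
        Sum.elim_inl, Sum.elim_inr, Sum.inl.injEq, reduceCtorEq, if_false]
  have upr : ∀ (σ : K → P) (τ : L → P) (i : L) (q : P),
      update (Sum.elim σ τ ∘ f.symm) (f (Sum.inr i)) q =
        Sum.elim σ (update τ i q) ∘ f.symm := by
    intro σ τ i q
    ext j
    obtain ⟨j, rfl⟩ := f.surjective j
    rcases j with j | j <;>
      simp only [comp_apply, Equiv.symm_apply_apply, update_apply, f.injective.eq_iff,
        Sum.elim_inl, Sum.elim_inr, Sum.inr.injEq, reduceCtorEq, if_false]
  refine .of_run
    { inp := Sum.elim (fun x => (f (Sum.inl x.1), x.2)) (fun x => (f (Sum.inr x.1), x.2))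
      out := fun x => some (Sum.inl (Sum.elim (fun k => Sum.inl (k, x.2))
        (fun l => Sum.inr (l, x.2)) (f.symm x.1)))
      inp_injective := by
        rintro (⟨i, a⟩ | ⟨i, a⟩) (⟨j, b⟩ | ⟨j, b⟩) h <;> simp at h
        · rw [h.1, h.2]
        · rw [h.1, h.2]
      out_injective := by
        rintro ⟨x, a⟩ ⟨y, b⟩ t hx hy
        obtain ⟨x, rfl⟩ := f.surjective x
        obtain ⟨y, rfl⟩ := f.surjective y
        rw [← hy] at hx
        rcases x with x | x <;> rcases y with y | y <;> simp at hx
        · rw [hx.1, hx.2]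
        · rw [hx.1, hx.2]
      out_ne_inp := by simp }
    (fun p => Sum.elim p.1 p.2 ∘ f.symm) 1 ?_ ?_
  · rintro ⟨σ, τ⟩ ⟨σ', τ'⟩ h
    have h' := f.symm.surjective.injective_comp_right h
    exact Prod.ext (funext fun i => congrFun h' (Sum.inl i))
      (funext fun i => congrFun h' (Sum.inr i))
  · rintro ⟨σ, τ⟩ (⟨i, a⟩ | ⟨i, a⟩) t ht
    · simp only [PartialMachine.par, pow, Option.map_map, Option.mem_def,
        Option.map_eq_some_iff, Prod.exists] at ht
      obtain ⟨q, b, h, rfl⟩ := ht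
      simp only [run, pow, comp_apply, Equiv.symm_apply_apply, Sum.elim_inl, h,
        Option.map_some, upl]
    · simp only [PartialMachine.par, pow, Option.map_map, Option.mem_def,
        Option.map_eq_some_iff, Prod.exists] at ht
      obtain ⟨q, b, h, rfl⟩ := ht
      simp only [run, pow, comp_apply, Equiv.symm_apply_apply, Sum.elim_inr, h,
        Option.map_some, upr]

theorem Simulates.pow {P A B P' A' B' : Type*} {S : PartialMachine P A B}
    {T : PartialMachine P' A' B'} (h : S.Simulates T) (K : Type*) [DecidableEq K] :
    (S.pow K).Simulates (T.pow K) := by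
  obtain ⟨V, e, he, hV⟩ := h
  let W : Wiring (K × A) (K × B) (K × A') (K × B') :=
    { inp := Prod.map id V.inp
      out := fun x => (V.out x.2).map (Sum.map (Prod.mk x.1) (Prod.mk x.1))
      inp_injective := injective_id.prodMap V.inp_injective
      out_injective := by
        rintro ⟨i, x⟩ ⟨j, y⟩ t hx hy
        simp only [Option.map_eq_some_iff] at hx hy
        obtain ⟨u, hu, rfl⟩ := hx
        obtain ⟨v, hv, e⟩ := hy
        rcases u with u | u <;> rcases v with v | v <;> simp at e
        · obtain ⟨rfl, rfl⟩ := e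
          rw [V.out_injective _ _ _ hu hv]
        · obtain ⟨rfl, rfl⟩ := e
          rw [V.out_injective _ _ _ hu hv]
      out_ne_inp := by
        rintro ⟨i, x⟩ ⟨j, a⟩ h
        simp only [Option.map_eq_some_iff] at h
        obtain ⟨u, hu, e⟩ := h
        rcases u with u | u <;> simp at e
        obtain ⟨rfl, rfl⟩ := e
        exact V.out_ne_inp _ _ hu }
  have key : ∀ {p a q b} (σ : K → P) (i : K), σ i = p → Route S V p a q b →
      Route (S.pow K) W σ (i, a) (update σ i q) (i, b) := by
    intro p a q b σ i hσ h
    induction h generalizing σ with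
    | exit h hb =>
      subst hσ
      exact .exit (b := (i, _)) (by simp only [PartialMachine.pow, h]; rfl) (by simp [W, hb])
    | @loop p a q b a₁ r b' h hb _ ih =>
      subst hσ
      have := ih (update σ i q) (by simp)
      rw [update_idem] at this
      exact .loop (b := (i, b)) (by simp only [PartialMachine.pow, h]; rfl)
        (by simp only [W, hb]; rfl) this
  refine ⟨W, fun σ => e ∘ σ, he.comp_left, ?_⟩
  rintro σ ⟨i, a⟩ τ ⟨j, b⟩ h
  simp only [PartialMachine.pow, Option.map_eq_some_iff, Prod.exists] at h
  obtain ⟨q, c, h, e'⟩ := h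
  simp only [Prod.mk.injEq] at e'
  obtain ⟨rfl, rfl, rfl⟩ := e'
  have := key (e ∘ σ) i rfl (hV _ _ _ _ h)
  rwa [← comp_update] at this

end PartialMachine

open PartialMachine

/-! ### Partial machines built from copies of one element -/

/-- The partial machine `T` is realized by finitely many copies of `M`, suitably wired. -/
def SequentialMachine.CanBuild {Q S G P A B : Type*} (M : SequentialMachine Q S G)
    (T : PartialMachine P A B) : Prop :=
  ∃ m : ℕ, (M.toPartial.pow (Fin m)).Simulates T

namespace SequentialMachine.CanBuild

variable {Q S G P A B P' A' B' : Type*} {M : SequentialMachine Q S G}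
  {T : PartialMachine P A B} {U : PartialMachine P' A' B'}

theorem refl (M : SequentialMachine Q S G) : M.CanBuild M.toPartial :=
  ⟨1, .of_run
    { inp := fun a => (0, a)
      out := fun x => some (.inl x.2)
      inp_injective := fun a b h => (Prod.ext_iff.1 h).2
      out_injective := fun x y t hx hy => Prod.ext (Subsingleton.elim _ _)
        (Sum.inl_injective (Option.some_injective _ (hx.trans hy.symm)))
      out_ne_inp := by simp }
    (fun q _ => q) 1 (fun p q h => congrFun h 0) (by
      rintro q a _ ⟨⟩
      simp only [run, PartialMachine.pow, toPartial, Option.map_some, Option.some.injEq,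
        Prod.mk.injEq, and_true]
      exact funext fun i => by rw [Subsingleton.elim i 0, update_self])⟩

theorem trans (h : M.CanBuild T) (hTU : T.Simulates U) : M.CanBuild U :=
  h.imp fun _ hm => hm.trans hTU

theorem par (hT : M.CanBuild T) (hU : M.CanBuild U) : M.CanBuild (T.par U) := by
  obtain ⟨m, hm⟩ := hT
  obtain ⟨n, hn⟩ := hU
  exact ⟨m + n, (pow_simulates_par _ finSumFinEquiv).trans (hm.par hn)⟩

/-- A machine builds what is built by a machine that it simulates. -/
theorem of_simulates {Q' S' G' : Type*} {N : SequentialMachine Q' S' G'}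
    (h : M.toPartial.Simulates N.toPartial) (hT : N.CanBuild T) : M.CanBuild T :=
  hT.imp fun _ hm => (h.pow _).trans hm

end SequentialMachine.CanBuild

namespace PartialMachine

/-! ### Elements with two states and two symbols -/

/-- The reading toggle: both inputs report the state, the input `true` also flips it. -/
def readToggle : PartialMachine Bool Bool Bool :=
  fun q x => some (x ^^ q, q)

/-- The inverse reading toggle: the input is written into the state, and the output reports
whether the state has changed. -/
def writeCompare : PartialMachine Bool Bool Bool :=
  fun q x => some (x, q ^^ x)

/-- A memory cell.  In the state `false`, the input `true` writes the bit; the input `false`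
reads the bit destructively, and the output `false` reports that it was set. -/
def cell : PartialMachine Bool Bool Bool
  | false, d => some (d, true)
  | true, false => some (false, false)
  | true, true => none

theorem readToggle_par_writeCompare_simulates_cell :
    (readToggle.par writeCompare).Simulates cell :=
  .of_run
    { inp := fun d => bif d then .inr true else .inl false
      out := fun
        | .inl false => some (.inl true)
        | .inl true => some (.inr (.inr false))
        | .inr false => some (.inl false)
        | .inr true => some (.inr (.inl true))
      inp_injective := by decide
      out_injective := by decide
      out_ne_inp := by decide }
    (fun q => (q, q)) 4 (by decide) (by decide)

/-! ### A reversible element with two states and three symbols -/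

/-- A two-state three-symbol element.  In the state `false`, the inputs `0` and `1` both leave
through the output `0` but are told apart by the new state.  In both states, the input `2` resets the
state to `false` and leaves through the output `1` or `2` according to the old state.  In the state
`true`, the inputs `0` and `1` leave through the outputs `2` and `1`. -/
def mergeSplit : PartialMachine Bool (Fin 3) (Fin 3) := fun q x =>
  some <| bif q then ![(true, 2), (true, 1), (false, 2)] x
    else ![(false, 0), (true, 0), (false, 1)] x

theorem readToggle_par_writeCompare_simulates_mergeSplit :
    (readToggle.par writeCompare).Simulates mergeSplit :=
  .of_run
    { inp := ![.inl false, .inr true, .inr false]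
      out := fun
        | .inl false => some (.inl 0)
        | .inl true => some (.inl 2)
        | .inr false => some (.inl 1)
        | .inr true => some (.inr (.inl true))
      inp_injective := by decide
      out_injective := by decide
      out_ne_inp := by decide }
    (fun q => (q, q)) 3 (by decide) (by decide)

/-! ### Marking and retrieving -/

/-- A single mark, which can be set unconditionally (input `2`) or while passing through
(inputs `0` and `1` share the output `0`), and which can be cleared by a signal that
finds it (input `0`) or by a signal that knows it to be set (input `3`). -/
def latch : PartialMachine Bool (Fin 4) (Fin 4) := fun q x =>
  bif q then ![some (false, 2), none, none, some (false, 3)] x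
    else ![some (false, 0), some (true, 0), some (true, 1), none] x

theorem mergeSplit_simulates_latch :
    (mergeSplit.par (mergeSplit.par mergeSplit)).Simulates latch :=
  .of_run
    { inp := ![.inl 0, .inr (.inr 0), .inr (.inr 1), .inl 1]
      out := Sum.elim ![some (.inr (.inr (.inl 0))), some (.inl 2), some (.inl 3)]
        (Sum.elim
          ![some (.inr (.inr (.inr 2))), some (.inr (.inl 2)), some (.inr (.inr (.inl 2)))]
          ![some (.inr (.inr (.inl 1))), some (.inl 0), some (.inl 1)])
      inp_injective := by decide
      out_injective := by decide
      out_ne_inp := by decide }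
    (fun q => (false, q, false)) 8 (by decide) (by decide)

/-- A bank of rows, at most one of which is marked.  A signal travelling in one of two directions
`d` through the unmarked bank just passes; a signal entering through the row `i` marks this row
and goes on in the direction `d`; a signal that passes through the marked bank is diverted into
the marked row, and the mark is removed. -/
def bank (I : Type*) : PartialMachine (Option I) (Bool × I ⊕ Bool) (Bool × I ⊕ Bool)
  | none, .inl (d, i) => some (some i, .inr d)
  | none, .inr d => some (none, .inr d)
  | some i, .inr d => some (none, .inl (d, i))
  | some _, .inl _ => none

/-- The two latches hold the same mark, one for each direction.  A signal that sets the mark passes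
the latch of the other direction first, then merges at its own latch with the signals that just
pass; a signal that finds the mark in the latch of its direction clears the other one, whose state
is then known. -/
theorem latch_simulates_bank_unit : (latch.par latch).Simulates (bank Unit) :=
  .of_run
    { inp := fun
        | .inl (false, ()) => .inr 2
        | .inl (true, ()) => .inl 2
        | .inr false => .inl 0
        | .inr true => .inr 0
      out := Sum.elim
        ![some (.inl (.inr false)), some (.inr (.inr 1)), some (.inr (.inr 3)),
          some (.inl (.inl (true, ())))]
        ![some (.inl (.inr true)), some (.inr (.inl 1)), some (.inr (.inl 3)),
          some (.inl (.inl (false, ())))]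
      inp_injective := by decide
      out_injective := by decide
      out_ne_inp := by decide }
    (fun q => (q.isSome, q.isSome)) 3 (by decide) (by decide)

theorem bank_unit_simulates_bank_empty : (bank Unit).Simulates (bank PEmpty) :=
  .of_run
    { inp := Sum.elim (fun x => x.2.elim) .inr
      out := Sum.elim (fun _ => none) (fun d => some (.inl (.inr d)))
      inp_injective := by decide
      out_injective := by decide
      out_ne_inp := by decide }
    (fun _ => none) 1 (by decide) (by decide)

theorem bank_congr {I J : Type*} (e : I ≃ J) : (bank I).Simulates (bank J) :=
  .of_run
    { inp := Sum.map (Prod.map id e.symm) id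
      out := fun x => some (.inl (x.map (Prod.map id e) id))
      inp_injective :=
        Sum.map_injective.2 ⟨injective_id.prodMap e.symm.injective, injective_id⟩
      out_injective := fun x y t hx hy =>
        Sum.map_injective.2 ⟨injective_id.prodMap e.injective, injective_id⟩
          (Sum.inl_injective (Option.some_injective _ (hx.trans hy.symm)))
      out_ne_inp := by simp }
    (Option.map e.symm) 1 (Option.map_injective e.symm.injective) (by
      rintro (_ | i) (⟨d, j⟩ | d) t ht <;> simp [bank, run] at ht ⊢ <;> subst ht <;> simp)

/-- Rows are added by stacking them on the two lines along which signals pass. -/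
theorem bank_simulates_bank_option (I : Type*) :
    ((bank Unit).par (bank I)).Simulates (bank (Option I)) :=
  .of_run
    { inp := fun
        | .inl (d, none) => .inl (.inl (d, ()))
        | .inl (d, some i) => .inr (.inl (d, i))
        | .inr false => .inl (.inr false)
        | .inr true => .inr (.inr true)
      out := fun
        | .inl (.inl (d, _)) => some (.inl (.inl (d, none)))
        | .inl (.inr true) => some (.inl (.inr true))
        | .inl (.inr false) => some (.inr (.inr (.inr false)))
        | .inr (.inl (d, i)) => some (.inl (.inl (d, some i)))
        | .inr (.inr false) => some (.inl (.inr false))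
        | .inr (.inr true) => some (.inr (.inl (.inr true)))
      inp_injective := by
        rintro (⟨d, _ | i⟩ | _ | _) (⟨d', _ | i'⟩ | _ | _) h <;> simp at h ⊢ <;> exact h
      out_injective := by
        rintro ((⟨d, _⟩ | _ | _) | (⟨d, _⟩ | _ | _)) ((⟨d, _⟩ | _ | _) | (⟨d, _⟩ | _ | _)) t
          hx hy <;> cases hx <;> cases hy <;> rfl
      out_ne_inp := by
        rintro ((⟨d, _⟩ | _ | _) | (⟨d, _⟩ | _ | _)) (⟨d', _ | i'⟩ | _ | _) <;> simp }
    (fun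
      | none => (none, none)
      | some none => (some (), none)
      | some (some i) => (none, some i))
    3 (by rintro (_ | _ | i) (_ | _ | j) h <;> simp at h ⊢; exact h)
    (by
      rintro (_ | _ | i) (⟨d, _ | j⟩ | _ | _) t ht <;> cases ht <;>
        first | rfl | (cases d <;> rfl))

/-! ### Memory cells with many ports -/

/-- A memory cell that is accessed through the ports `i : I`; the signal leaves on the output line
with the number `i` of its port, which the cell itself ignores. -/
def sharedCell (I : Type*) : PartialMachine Bool (Bool × I) (Bool × I) :=
  fun q x => (cell q x.1).map fun t => (t.1, (t.2, x.2))

/-- The bank remembers the port while the signal visits the cell.  The direction in which the signal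
leaves the cell tells whether the bit was found set, and so does the line on which the bank returns
the signal to its port. -/
theorem bank_par_cell_simulates_sharedCell (I : Type*) :
    ((bank I).par cell).Simulates (sharedCell I) :=
  .of_run
    { inp := fun x => .inl (.inl x)
      out := fun
        | .inl (.inl x) => some (.inl x)
        | .inl (.inr d) => some (.inr (.inr d))
        | .inr d => some (.inr (.inl (.inr d)))
      inp_injective := by intro x y h; simpa using h
      out_injective := by
        rintro ((x | x) | x) ((y | y) | y) t hx hy <;> cases hx <;> cases hy <;> rfl
      out_ne_inp := by rintro ((x | x) | x) a <;> simp }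
    (fun q => (none, q)) 3 (by intro x y h; simpa using h)
    (by rintro (_ | _) ⟨_ | _, i⟩ t ht <;> cases ht <;> rfl)

/-- A row of shared cells `p : P`, at most one of which is set.  A signal at the port `i` that
runs through the row is diverted by the cell that is set, which is thereby cleared, and passes
if there is none; through additional ports the cell `p` can be set. -/
def cellRow (P I : Type*) : PartialMachine (Option P) (I ⊕ P × I) (I ⊕ P × I)
  | none, .inl i => some (none, .inl i)
  | none, .inr (p, i) => some (some p, .inl i)
  | some p, .inl i => some (none, .inr (p, i))
  | some _, .inr _ => none

theorem sharedCell_simulates_cellRow_empty (I : Type*) :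
    (sharedCell I).Simulates (cellRow PEmpty I) :=
  .of_run
    { inp := Sum.elim (fun i => (false, i)) (fun x => x.1.elim)
      out := fun x => bif x.1 then some (.inl (.inl x.2)) else none
      inp_injective := by rintro (i | ⟨p, i⟩) (j | ⟨q, j⟩) h <;> first | (cases ‹PEmpty›) | simp_all
      out_injective := by rintro ⟨_ | _, i⟩ ⟨_ | _, j⟩ t hx hy <;> cases hx <;> cases hy; rfl
      out_ne_inp := by rintro ⟨_ | _, i⟩ a <;> simp }
    (fun _ => false) 1 (fun p q _ => Subsingleton.elim p q)
    (by rintro (_ | p) (i | ⟨p, i⟩) t ht <;> first | (cases ‹PEmpty›) | (cases ht; rfl))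

theorem cellRow_congr {P P' : Type*} (I : Type*) (e : P ≃ P') :
    (cellRow P I).Simulates (cellRow P' I) :=
  .of_run
    { inp := Sum.map id (Prod.map e.symm id)
      out := fun x => some (.inl (x.map id (Prod.map e id)))
      inp_injective :=
        Sum.map_injective.2 ⟨injective_id, e.symm.injective.prodMap injective_id⟩
      out_injective := fun x y t hx hy =>
        Sum.map_injective.2 ⟨injective_id, e.injective.prodMap injective_id⟩
          (Sum.inl_injective (Option.some_injective _ (hx.trans hy.symm)))
      out_ne_inp := by simp }
    (Option.map e.symm) 1 (Option.map_injective e.symm.injective) (by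
      rintro (_ | p) (i | ⟨q, i⟩) t ht <;> simp [cellRow, run] at ht ⊢ <;> subst ht <;> simp)

theorem sharedCell_par_cellRow_simulates_cellRow_option (P I : Type*) :
    ((sharedCell I).par (cellRow P I)).Simulates (cellRow (Option P) I) :=
  .of_run
    { inp := fun
        | .inl i => .inl (false, i)
        | .inr (none, i) => .inl (true, i)
        | .inr (some p, i) => .inr (.inr (p, i))
      out := fun
        | .inl (true, i) => some (.inr (.inr (.inl i)))
        | .inl (false, i) => some (.inl (.inr (none, i)))
        | .inr (.inl i) => some (.inl (.inl i))
        | .inr (.inr (p, i)) => some (.inl (.inr (some p, i)))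
      inp_injective := by
        rintro (i | ⟨_ | p, i⟩) (j | ⟨_ | q, j⟩) h <;> simp at h ⊢ <;> exact h
      out_injective := by
        rintro (⟨_ | _, i⟩ | i | ⟨p, i⟩) (⟨_ | _, j⟩ | j | ⟨q, j⟩) t hx hy <;> cases hx <;>
          cases hy <;> rfl
      out_ne_inp := by
        rintro (⟨_ | _, i⟩ | i | ⟨p, i⟩) (j | ⟨_ | q, j⟩) <;> simp }
    (fun
      | none => (false, none)
      | some none => (true, none)
      | some (some p) => (false, some p))
    2 (by rintro (_ | _ | i) (_ | _ | j) h <;> simp at h ⊢; exact h)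
    (by rintro (_ | _ | p) (i | ⟨_ | q, i⟩) t ht <;> cases ht <;> rfl)

/-! ### Arbitrary reversible machines -/

/-- The state `p` is kept in the cell `p` of the row.  An input signal finds the cell that is set
and leaves it on a line that determines state and input; this line leads to the port which sets
the cell of the next state and lets the signal pass to the right output. -/
theorem cellRow_simulates_reversible {P A B : Type*} (N : SequentialMachine P A B)
    (hN : N.IsReversible) (f : A ↪ B) : (cellRow P B).Simulates N.toPartial := by
  classical
  have hf : ∀ {a b}, partialInv f b = some a ↔ f a = b := fun {a b} =>
    f.injective.isPartialInv a b
  let W : Wiring (B ⊕ P × B) (B ⊕ P × B) A B :=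
    { inp := fun a => .inl (f a)
      out := Sum.elim (fun b => some (.inl b))
        (fun x => (partialInv f x.2).map fun a => .inr (.inr (N.move x.1 a)))
      inp_injective := fun a b h => f.injective (by simpa using h)
      out_injective := by
        rintro (b | ⟨p, b⟩) (c | ⟨q, c⟩) t hx hy
        · simpa using hx.trans hy.symm
        · simp at hx hy; subst hx; simp at hy
        · simp at hx hy; subst hy; simp at hx
        · simp only [Sum.elim_inr, Option.map_eq_some_iff] at hx hy
          obtain ⟨a, ha, rfl⟩ := hx
          obtain ⟨d, hd, e⟩ := hy
          have := @hN (q, d) (p, a) (by simpa using e)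
          simp only [Prod.mk.injEq] at this
          obtain ⟨rfl, rfl⟩ := this
          rw [hf] at ha hd
          rw [← ha, ← hd]
      out_ne_inp := by
        rintro (b | ⟨p, b⟩) a <;> simp }
  refine ⟨W, some, Option.some_injective _, fun p a q b h => ?_⟩
  refine .loop (q := none) (b := .inr (p, f a)) (a₁ := .inr (N.move p a)) rfl ?_
    (.exit (q := some q) (b := .inl b) ?_ rfl)
  · simp only [W, Sum.elim_inr, Option.map_eq_some_iff]
    exact ⟨a, hf.2 rfl, rfl⟩
  · have : N.move p a = (q, b) := by simpa [SequentialMachine.toPartial] using h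
    rw [this]
    rfl

end PartialMachine

namespace SequentialMachine.CanBuild

variable {Q S G : Type*} {M : SequentialMachine Q S G}

theorem bank (hM : M.CanBuild (PartialMachine.bank Unit)) (I : Type) [Finite I] :
    M.CanBuild (PartialMachine.bank I) := by
  induction I using Finite.induction_empty_option with
  | of_equiv e h => exact h.trans (bank_congr e)
  | h_empty => exact hM.trans bank_unit_simulates_bank_empty
  | h_option h => exact (hM.par h).trans (bank_simulates_bank_option _)

theorem cellRow {I : Type*} (hM : M.CanBuild (sharedCell I)) (P : Type) [Finite P] :
    M.CanBuild (PartialMachine.cellRow P I) := by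
  induction P using Finite.induction_empty_option with
  | of_equiv e h => exact h.trans (cellRow_congr I e)
  | h_empty => exact hM.trans (sharedCell_simulates_cellRow_empty I)
  | h_option h => exact (hM.par h).trans (sharedCell_par_cellRow_simulates_cellRow_option _ I)

/-- A machine that builds the reading toggle and its inverse builds every reversible machine. -/
theorem of_isReversible (hR : M.CanBuild readToggle) (hW : M.CanBuild writeCompare)
    {P A B : Type} [Finite P] [Finite B] (N : SequentialMachine P A B) (hN : N.IsReversible)
    (f : A ↪ B) : M.CanBuild N.toPartial := by
  have hG : M.CanBuild mergeSplit :=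
    (hR.par hW).trans readToggle_par_writeCompare_simulates_mergeSplit
  have hL : M.CanBuild latch := (hG.par (hG.par hG)).trans mergeSplit_simulates_latch
  have hE : M.CanBuild (PartialMachine.bank Unit) := (hL.par hL).trans latch_simulates_bank_unit
  have hC : M.CanBuild cell := (hR.par hW).trans readToggle_par_writeCompare_simulates_cell
  have hS : M.CanBuild (sharedCell B) :=
    ((hE.bank B).par hC).trans (bank_par_cell_simulates_sharedCell B)
  exact (hS.cellRow P).trans (cellRow_simulates_reversible N hN f)

end SequentialMachine.CanBuild

/-! ### From wirings with open ends to circuits -/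

/-- If there are at least as many targets as sources, a partial connection without merging lines
extends to a total one. -/
theorem exists_injective_extend {X Y : Type*} [Finite X] [Finite Y]
    (hXY : Nat.card X ≤ Nat.card Y) (g : X → Option Y)
    (hg : ∀ x y t, g x = some t → g y = some t → x = y) :
    ∃ f : X → Y, Injective f ∧ ∀ x t, g x = some t → f x = t := by
  classical
  have := Fintype.ofFinite X
  have := Fintype.ofFinite Y
  rcases isEmpty_or_nonempty Y with hY | ⟨⟨y₀⟩⟩
  · have : IsEmpty X := by
      rw [Nat.card_of_isEmpty (α := Y), Nat.le_zero, Finite.card_eq_zero_iff] at hXY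
      exact hXY
    exact ⟨fun x => isEmptyElim x, fun x => isEmptyElim x, fun x => isEmptyElim x⟩
  let s : Finset X := Finset.univ.filter fun x => (g x).isSome
  let h : X → Y := fun x => (g x).getD y₀
  have hs : Set.InjOn h s := by
    intro x hx y hy e
    simp only [s, Finset.coe_filter, Finset.mem_univ, true_and, Set.mem_ofPred_eq,
      Option.isSome_iff_exists] at hx hy
    obtain ⟨t, ht⟩ := hx
    obtain ⟨u, hu⟩ := hy
    simp only [h, ht, hu, Option.getD_some] at e
    exact hg x y t ht (e ▸ hu)
  obtain ⟨t, hst, -, ht⟩ := Finset.exists_subsuperset_card_eq (Finset.subset_univ (s.image h))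
    (n := Fintype.card X) ((Finset.card_image_of_injOn hs).trans_le (Finset.card_le_univ s))
    (by simpa [Nat.card_eq_fintype_card] using hXY)
  obtain ⟨e, he⟩ := Finset.exists_equiv_extend_of_card_eq ht.symm hst hs
  refine ⟨fun x => e x, fun x y hxy => e.injective (Subtype.ext hxy), fun x t hx => ?_⟩
  simp [he x (by simp [s, hx]), h, hx]

theorem SequentialMachine.CanBuild.exists_realizes {Q S G P A B : Type*} [Finite S] [Finite G]
    [Finite A] [Finite B] {M : SequentialMachine Q S G} {N : SequentialMachine P A B}
    (h : M.CanBuild N.toPartial) (hSG : Nat.card G = Nat.card S)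
    (hAB : Nat.card A ≤ Nat.card B) :
    ∃ (m : ℕ) (C : ElementCircuit m S G A B), C.Realizes M N := by
  obtain ⟨m, W, enc, henc, hW⟩ := h
  obtain ⟨f, hf, hfW⟩ := exists_injective_extend (X := A ⊕ Fin m × G) (Y := B ⊕ Fin m × S)
    (by simp only [Nat.card_sum, Nat.card_prod, hSG]; lia)
    (Sum.elim (fun a => some (.inr (W.inp a))) W.out)
    (by
      rintro (a | x) (b | y) t hx hy
      · simp only [Sum.elim_inl, Option.some.injEq] at hx hy
        rw [← hy, Sum.inr.injEq] at hx
        rw [W.inp_injective hx]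
      · simp only [Sum.elim_inl, Sum.elim_inr, Option.some.injEq] at hx hy
        exact absurd (hx ▸ hy) (W.out_ne_inp _ _)
      · simp only [Sum.elim_inl, Sum.elim_inr, Option.some.injEq] at hx hy
        exact absurd (hy ▸ hx) (W.out_ne_inp _ _)
      · rw [W.out_injective _ _ _ hx hy])
  refine ⟨m, ⟨f, hf⟩, enc, henc, fun p a => ?_⟩
  have key : ∀ {σ x τ b}, Route (M.toPartial.pow (Fin m)) W σ x τ b →
      ElementCircuit.Travels ⟨f, hf⟩ M σ (.inr x) τ b := by
    intro σ x τ b h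
    induction h with
    | @exit σ x τ y b h hb =>
      simp only [PartialMachine.pow, SequentialMachine.toPartial, Option.map_some,
        Option.some.injEq, Prod.mk.injEq] at h
      obtain ⟨rfl, rfl⟩ := h
      refine .pass _ _ _ _ _ ?_
      rw [show (ElementCircuit.mk f hf).conn _ = _ from hfW (.inr _) _ hb]
      exact .leave _ _
    | @loop σ x τ y x' υ b h hb _ ih =>
      simp only [PartialMachine.pow, SequentialMachine.toPartial, Option.map_some,
        Option.some.injEq, Prod.mk.injEq] at h
      obtain ⟨rfl, rfl⟩ := h
      refine .pass _ _ _ _ _ ?_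
      rw [show (ElementCircuit.mk f hf).conn _ = _ from hfW (.inr _) _ hb]
      exact ih
  rw [show (ElementCircuit.mk f hf).conn (.inl a) = _ from hfW (.inl a) _ rfl]
  exact key (hW p a _ _ rfl)

namespace SequentialMachine

/-! ### Feedback -/

section Feedback

variable {S G : Type*} [DecidableEq G] (M : SequentialMachine Bool S G) (g : G) (s : S)

/-- The passage of a signal through `M` whose output port `g` is connected to the input port `s`.
Since `M` is reversible with two states, at most two turns through the feedback line occur. -/
def feedbackMove (q : Bool) (t : S) : Bool × G :=
  if (M.move q t).2 = g then
    if (M.move (M.move q t).1 s).2 = g then M.move (M.move (M.move q t).1 s).1 s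
    else M.move (M.move q t).1 s
  else M.move q t

variable {M g s}

theorem IsReversible.eq_of_move_eq {Q S G : Type*} {M : SequentialMachine Q S G}
    (hM : M.IsReversible) {q q' : Q} {t t' : S} (h : M.move q t = M.move q' t') :
    q = q' ∧ t = t' :=
  Prod.ext_iff.1 (@hM (q, t) (q', t') h)

theorem feedbackMove_snd_ne (hM : M.IsReversible) {q : Bool} {t : S} (ht : t ≠ s) :
    (M.feedbackMove g s q t).2 ≠ g := by
  unfold feedbackMove
  split_ifs with h₁ h₂
  · intro h₃
    -- the three pairs `(q, t)`, `(a, s)`, `(b, s)` are mapped to the two pairs with output `g`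
    obtain ⟨a, ha⟩ : ∃ a, M.move q t = (a, g) := ⟨_, Prod.ext rfl h₁⟩
    rw [ha] at h₂ h₃
    obtain ⟨b, hb⟩ : ∃ b, M.move a s = (b, g) := ⟨_, Prod.ext rfl h₂⟩
    rw [hb] at h₃
    obtain ⟨c, hc⟩ : ∃ c, M.move b s = (c, g) := ⟨_, Prod.ext rfl h₃⟩
    have hab : a ≠ b := by
      rintro rfl
      exact ht (hM.eq_of_move_eq (ha.trans hb.symm)).2
    have hbc : b ≠ c := by
      rintro rfl
      exact hab (hM.eq_of_move_eq (hb.trans hc.symm)).1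
    obtain rfl : a = c := by
      cases a <;> cases b <;> cases c <;> simp_all
    exact ht (hM.eq_of_move_eq (ha.trans hc.symm)).2
  · exact h₂
  · exact h₁

theorem feedbackMove_injective (hM : M.IsReversible) {q q' : Bool} {t t' : S} (ht : t ≠ s)
    (ht' : t' ≠ s) (h : M.feedbackMove g s q t = M.feedbackMove g s q' t') :
    q = q' ∧ t = t' := by
  have key : ∀ {q q' t t'}, M.move q t = M.move q' t' → q = q' ∧ t = t' := hM.eq_of_move_eq
  unfold feedbackMove at h
  split_ifs at h with h₁ h₂ h₃ h₄ h₅ h₆ h₇ h₈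
  all_goals
    have := key h
    first
      | exact this
      | exact absurd this.2 ht
      | exact absurd this.2.symm ht'
      | skip
  · have e := key (Prod.ext this.1 (h₂.trans h₄.symm))
    exact key (Prod.ext e.1 (h₁.trans h₃.symm))
  · have e := key (Prod.ext this.1 (h₂.trans h₃.symm))
    exact absurd e.2.symm ht'
  · have e := key (Prod.ext this.1 (h₁.trans (Eq.symm ‹(M.move (M.move q' t').1 s).2 = g›)))
    exact absurd e.2 ht
  · exact key (Prod.ext this.1 (h₁.trans (Eq.symm ‹(M.move q' t').2 = g›)))

variable (M g s) in
/-- The machine obtained from a reversible machine with two states by connecting the output port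
`g` to the input port `s`. -/
def feedback (hM : M.IsReversible) :
    SequentialMachine Bool {t : S // t ≠ s} {x : G // x ≠ g} where
  move q t := ((M.feedbackMove g s q t).1, ⟨(M.feedbackMove g s q t).2,
    feedbackMove_snd_ne hM t.2⟩)

theorem feedback_isReversible (hM : M.IsReversible) : (M.feedback g s hM).IsReversible := by
  rintro ⟨q, t, ht⟩ ⟨q', t', ht'⟩ h
  simp only [feedback, Prod.mk.injEq, Subtype.mk.injEq] at h
  obtain ⟨rfl, rfl⟩ := feedbackMove_injective hM ht ht' (Prod.ext h.1 h.2)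
  rfl

theorem simulates_feedback (hM : M.IsReversible) :
    M.toPartial.Simulates (M.feedback g s hM).toPartial :=
  .of_run
    { inp := Subtype.val
      out := fun x => some (if h : x = g then .inr s else .inl ⟨x, h⟩)
      inp_injective := Subtype.val_injective
      out_injective := by
        intro x y t hx hy
        rw [← hy, Option.some.injEq] at hx
        split_ifs at hx with h₁ h₂ h₂
        · rw [h₁, h₂]
        · exact congrArg Subtype.val (Sum.inl_injective hx)
      out_ne_inp := by
        intro x a h
        rw [Option.some.injEq] at h
        split_ifs at h with hx
        exact a.2 (Sum.inr_injective h).symm }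
    id 3 injective_id (by
      rintro q ⟨t, ht⟩ _ ⟨⟩
      have h₀ := feedbackMove_snd_ne (g := g) hM (q := q) ht
      simp only [feedback, id, run, toPartial]
      revert h₀
      unfold feedbackMove
      split_ifs <;> simp_all)

end Feedback

/-! ### Reduction to three symbols -/

/-- A machine with two states is essential if no symbol is a plain wire, some move changes the
state, and some symbol is led to different outputs in the two states. -/
structure IsEssential {S G : Type*} (M : SequentialMachine Bool S G) : Prop where
  no_wire : ∀ t, (M.move false t).1 = false → (M.move true t).1 = true →
    (M.move false t).2 ≠ (M.move true t).2
  exists_toggle : ∃ q t, (M.move q t).1 = !q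
  exists_split : ∃ t, (M.move false t).2 ≠ (M.move true t).2

/-- Some feedback line leaves an essential machine with more than two symbols essential. -/
theorem IsEssential.exists_feedback {S G : Type*} [Finite S] [Finite G] [DecidableEq G]
    {M : SequentialMachine Bool S G}
    (h : M.IsEssential) (hM : M.IsReversible) (hS : 2 < Nat.card S)
    (hG : Nat.card G = Nat.card S) : ∃ g s, (M.feedback g s hM).IsEssential := by
  have split_ne : ∀ {q t}, (M.move false t).2 ≠ (M.move true t).2 →
      (M.move q t).2 ≠ (M.move (!q) t).2 := by
    intro q t ht
    cases q
    · exact ht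
    · exact ht.symm
  have key : ∀ {q q' t t'}, M.move q t = M.move q' t' → q = q' ∧ t = t' := hM.eq_of_move_eq
  -- a symbol with only one output: the moves exchange the states, as the symbol is no wire
  have toggle : ∀ {u}, (M.move false u).2 = (M.move true u).2 → ∀ q, (M.move q u).1 = !q := by
    intro u hu
    have h₁ : (M.move false u).1 ≠ (M.move true u).1 := fun e =>
      Bool.false_ne_true (key (Prod.ext e hu)).1
    have h₂ := h.no_wire u
    cases h₃ : (M.move false u).1 <;> cases h₄ : (M.move true u).1 <;> simp_all
  have only : ∀ {u}, (M.move false u).2 = (M.move true u).2 → ∀ {q t}, t ≠ u →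
      (M.move q t).2 ≠ (M.move false u).2 := by
    intro u hu q t ht e
    have h₁ := toggle hu (!(M.move q t).1)
    have h₂ : (M.move (!(M.move q t).1) u).2 = (M.move q t).2 := by
      rw [e]
      cases (M.move q t).1
      · exact hu.symm
      · rfl
    rw [Bool.not_not] at h₁
    exact ht (key (Prod.ext h₁ h₂)).2.symm
  by_cases hA : ∃ q t, (M.move q t).1 = !q ∧ (M.move false t).2 ≠ (M.move true t).2
  · obtain ⟨q₀, s₀, hq₀, hs₀⟩ := hA
    by_cases hu : ∃ u, (M.move false u).2 = (M.move true u).2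
    · -- drop a symbol that only toggles the state
      obtain ⟨u, hu⟩ := hu
      have same : ∀ {q t}, t ≠ u → M.feedbackMove (M.move false u).2 u q t = M.move q t :=
        fun ht => if_neg (only hu ht)
      have hs₀u : s₀ ≠ u := by rintro rfl; exact hs₀ hu
      refine ⟨(M.move false u).2, u, ⟨?_, ⟨q₀, ⟨s₀, hs₀u⟩, ?_⟩, ⟨s₀, hs₀u⟩, ?_⟩⟩
      · rintro ⟨t, ht⟩ h₁ h₂ h₃
        simp only [feedback, same ht, Subtype.mk.injEq] at h₁ h₂ h₃
        exact h.no_wire t h₁ h₂ h₃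
      · simpa only [feedback, same hs₀u] using hq₀
      · simpa only [feedback, same hs₀u, ne_eq, Subtype.mk.injEq] using hs₀
    · -- every symbol has two outputs; contract a line so that only one move changes
      push Not at hu
      have surj : Surjective fun p : Bool × S => M.move p.1 p.2 := by
        have : Nat.card (Bool × S) = Nat.card (Bool × G) := by
          simp only [Nat.card_prod, hG]
        exact (Nat.bijective_iff_injective_and_card _).2 ⟨hM, this⟩ |>.2
      obtain ⟨⟨r, s⟩, hrs⟩ := surj (!(M.move (!q₀) s₀).1, (M.move (!q₀) s₀).2)
      simp only at hrs
      have hr₁ : (M.move r s).1 = !(M.move (!q₀) s₀).1 := by rw [hrs]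
      have hr₂ : (M.move r s).2 = (M.move (!q₀) s₀).2 := by rw [hrs]
      set g := (M.move (!q₀) s₀).2 with hg
      have hs : s₀ ≠ s := by
        rintro rfl
        by_cases e : r = q₀
        · exact split_ne hs₀ (q := q₀) (by rw [← hg, ← hr₂, e])
        · obtain rfl : r = !q₀ := Bool.eq_not.2 e
          simp at hr₁
      have same : ∀ {q t}, t ≠ s → ¬ (q = !q₀ ∧ t = s₀) →
          M.feedbackMove g s q t = M.move q t := by
        intro q t ht hqt
        refine if_neg fun e => ?_
        by_cases e₁ : (M.move q t).1 = (M.move (!q₀) s₀).1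
        · exact hqt (key (Prod.ext e₁ e))
        · exact ht (key (q' := r) (t' := s) (Prod.ext
            (by rw [hr₁]; exact Bool.eq_not.2 e₁) (e.trans hr₂.symm))).2
      have same₀ : M.feedbackMove g s q₀ s₀ = M.move q₀ s₀ := same hs (by simp)
      refine ⟨g, s, ⟨?_, ⟨q₀, ⟨s₀, hs⟩, ?_⟩, ?_⟩⟩
      · rintro ⟨t, ht⟩ h₁ h₂ h₃
        by_cases e : t = s₀
        · subst e
          have : ∀ q, (M.feedbackMove g s q t).1 = q := by
            rintro (_ | _)
            · exact h₁
            · exact h₂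
          have := this q₀
          rw [same₀, hq₀] at this
          simp at this
        · simp only [feedback, same ht (fun h => e h.2), Subtype.mk.injEq] at h₃
          exact hu t h₃
      · simpa only [feedback, same₀] using hq₀
      · obtain ⟨t, ht₁, ht₂⟩ : ∃ t, t ≠ s ∧ t ≠ s₀ :=
          ENat.exists_ne_ne_of_three_le
            (by rw [ENat.card_eq_coe_natCard]; exact_mod_cast hS) s s₀
        refine ⟨⟨t, ht₁⟩, ?_⟩
        simpa only [feedback, same ht₁ (fun h => ht₂ h.2), ne_eq, Subtype.mk.injEq] using hu t
  · -- only symbols with a single output change the state; feed such a symbol `s₀` into a symbol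
    -- with two outputs
    push Not at hA
    obtain ⟨q₀, s₀, hq₀⟩ := h.exists_toggle
    obtain ⟨s₁, hs₁⟩ := h.exists_split
    have hs₀ : (M.move false s₀).2 = (M.move true s₀).2 := hA q₀ s₀ hq₀
    have stay : ∀ q, (M.move q s₁).1 = q := fun q => by
      by_contra e
      exact hs₁ (hA q s₁ (Bool.eq_not.2 e))
    have hne : s₀ ≠ s₁ := by rintro rfl; exact hs₁ hs₀
    have out₀ : ∀ q, (M.move q s₀).2 = (M.move false s₀).2 := by
      rintro (_ | _)
      · rfl
      · exact hs₀.symm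
    have same : ∀ {q t}, t ≠ s₀ → M.feedbackMove (M.move false s₀).2 s₁ q t = M.move q t :=
      fun ht => if_neg (only hs₀ ht)
    have same₀ : ∀ q, M.feedbackMove (M.move false s₀).2 s₁ q s₀ = M.move (!q) s₁ := fun q => by
      rw [feedbackMove, if_pos (out₀ q), if_neg (only hs₀ hne.symm), toggle hs₀]
    refine ⟨(M.move false s₀).2, s₁, ⟨?_, ⟨q₀, ⟨s₀, hne⟩, ?_⟩, ⟨s₀, hne⟩, ?_⟩⟩
    · rintro ⟨t, ht⟩ h₁ h₂ h₃
      by_cases e : t = s₀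
      · subst e
        simp [feedback, same₀, stay] at h₁
      · simp only [feedback, same e, Subtype.mk.injEq] at h₁ h₂ h₃
        exact h.no_wire t h₁ h₂ h₃
    · simp only [feedback, same₀, stay]
    · simp only [feedback, same₀, ne_eq, Subtype.mk.injEq]
      exact hs₁.symm

/-- Feedback lines reduce an essential machine to an essential machine with three symbols. -/
theorem IsEssential.exists_three.{u, v} (n : ℕ) : ∀ {S : Type u} {G : Type v} [Finite S] [Finite G]
    {M : SequentialMachine Bool S G}, M.IsEssential → M.IsReversible → Nat.card S = n + 3 →
    Nat.card G = n + 3 → ∃ (S' : Type u) (G' : Type v) (M' : SequentialMachine Bool S' G'),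
      M'.IsEssential ∧ M'.IsReversible ∧ Nat.card S' = 3 ∧ Nat.card G' = 3 ∧
      M.toPartial.Simulates M'.toPartial := by
  classical
  induction n with
  | zero => exact fun {S G _ _ M} h hM hS hG => ⟨S, G, M, h, hM, hS, hG, .refl _⟩
  | succ n ih =>
    intro S G _ _ M h hM hS hG
    obtain ⟨g, s, h'⟩ := h.exists_feedback hM (by lia) (by lia)
    have hS' : Nat.card {t : S // t ≠ s} = n + 3 := by
      rw [← Nat.card_congr (Equiv.optionSubtypeNe s), Finite.card_option] at hS
      lia
    have hG' : Nat.card {x : G // x ≠ g} = n + 3 := by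
      rw [← Nat.card_congr (Equiv.optionSubtypeNe g), Finite.card_option] at hG
      lia
    obtain ⟨S', G', M', h₁, h₂, h₃, h₄, h₅⟩ := ih h' (feedback_isReversible hM) hS' hG'
    exact ⟨S', G', M', h₁, h₂, h₃, h₄, (simulates_feedback hM).trans h₅⟩

end SequentialMachine

namespace SequentialMachine

/-! ### Essential machines with three symbols -/

/-- The machine `M` with the states renamed by the translation by `c`, and with the ports
renamed. -/
def relabel {S G S' G' : Type*} (M : SequentialMachine Bool S G) (c : Bool) (σ : S' → S)
    (τ : G → G') : SequentialMachine Bool S' G' where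
  move q s := ((M.move (q ^^ c) (σ s)).1 ^^ c, τ (M.move (q ^^ c) (σ s)).2)

theorem simulates_relabel {S G S' G' : Type*} (M : SequentialMachine Bool S G) (c : Bool)
    {σ : S' → S} {τ : G → G'} (hσ : Injective σ) (hτ : Injective τ) :
    M.toPartial.Simulates (M.relabel c σ τ).toPartial :=
  .of_run
    { inp := σ
      out := fun x => some (.inl (τ x))
      inp_injective := hσ
      out_injective := fun x y t hx hy =>
        hτ (Sum.inl_injective (Option.some_injective _ (hx.trans hy.symm)))
      out_ne_inp := by simp }
    (· ^^ c) 1 (fun _ _ => Bool.xor_left_inj.1) (by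
      rintro q s _ ⟨⟩
      simp [run, toPartial, relabel])

theorem IsReversible.relabel {S G S' G' : Type*} {M : SequentialMachine Bool S G}
    (hM : M.IsReversible) (c : Bool) {σ : S' → S} {τ : G → G'} (hσ : Injective σ)
    (hτ : Injective τ) : (M.relabel c σ τ).IsReversible := by
  rintro ⟨q, s⟩ ⟨q', s'⟩ h
  simp only [SequentialMachine.relabel, Prod.mk.injEq] at h
  have := hM.eq_of_move_eq (Prod.ext (Bool.xor_left_inj.1 h.1) (hτ h.2))
  exact Prod.ext (Bool.xor_left_inj.1 this.1) (hσ this.2)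

theorem IsEssential.relabel {S G S' G' : Type*} {M : SequentialMachine Bool S G}
    (hM : M.IsEssential) (c : Bool) (σ : S' ≃ S) {τ : G → G'}
    (hτ : Injective τ) : (M.relabel c σ τ).IsEssential := by
  obtain ⟨h₁, ⟨q, t, h₂⟩, ⟨u, h₃⟩⟩ := hM
  refine ⟨fun t => ?_, ⟨q ^^ c, σ.symm t, ?_⟩, ⟨σ.symm u, ?_⟩⟩
  · have := h₁ (σ t)
    cases c
    · simpa [SequentialMachine.relabel, hτ.ne_iff] using this
    · simpa [SequentialMachine.relabel, hτ.ne_iff] using fun a b => (this b a).symm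
  · simp [SequentialMachine.relabel, h₂]
  · cases c
    · simpa [SequentialMachine.relabel, hτ.ne_iff] using h₃
    · simpa [SequentialMachine.relabel, hτ.ne_iff] using h₃.symm

/-- The moves of a machine with two states and three symbols as a list of six numbers: the state
`q` and the symbol `s` together are coded by `3 * q + s`. -/
def code (M : SequentialMachine Bool (Fin 3) (Fin 3)) : List ℕ :=
  [(false, 0), (false, 1), (false, 2), (true, 0), (true, 1), (true, 2)].map fun x =>
    3 * (M.move x.1 x.2).1.toNat + (M.move x.1 x.2).2

/-- The machine with a given code. -/
def ofCode (c : List ℕ) : SequentialMachine Bool (Fin 3) (Fin 3) where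
  move q s :=
    let n := c.getD (3 * q.toNat + s) 0
    (Nat.ble 3 n, Fin.ofNat 3 n)

theorem ofCode_code (M : SequentialMachine Bool (Fin 3) (Fin 3)) : ofCode M.code = M := by
  have key : ∀ x : Bool × Fin 3,
      (Nat.ble 3 (3 * x.1.toNat + x.2), Fin.ofNat 3 (3 * x.1.toNat + x.2)) = x := by decide
  obtain ⟨move⟩ := M
  simp only [ofCode, mk.injEq]
  funext q s
  cases q <;> fin_cases s <;> exact key _

theorem code_perm {M : SequentialMachine Bool (Fin 3) (Fin 3)} (hM : M.IsReversible) :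
    M.code.Perm [3, 0, 1, 2, 4, 5] := by
  have hinj : Injective fun x : Bool × Fin 3 => 3 * x.1.toNat + (x.2 : ℕ) := by decide
  have hnd : M.code.Nodup := List.Nodup.map (hinj.comp hM) (by decide)
  have hlt : ∀ x : Bool × Fin 3, 3 * x.1.toNat + (x.2 : ℕ) ∈ [3, 0, 1, 2, 4, 5] := by decide
  refine (List.subperm_of_subset hnd fun n hn => ?_).perm_of_length_le (by simp [code])
  obtain ⟨x, -, rfl⟩ := List.mem_map.1 hn
  exact hlt _

/-- The permutations of three symbols. -/
def permutationsThree : List (Fin 3 → Fin 3) :=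
  [![0, 1, 2], ![0, 2, 1], ![1, 0, 2], ![1, 2, 0], ![2, 0, 1], ![2, 1, 0]]

theorem injective_of_mem_permutationsThree :
    ∀ σ ∈ permutationsThree, Injective σ := by decide

/-- One element with the output `2` connected to the input `2`. -/
def loopWiring : Wiring (Fin 3) (Fin 3) Bool Bool where
  inp x := bif x then 1 else 0
  out := ![some (.inl false), some (.inl true), some (.inr 2)]
  inp_injective := by decide
  out_injective := by decide
  out_ne_inp := by decide

/-- With the output `2` connected to the input `2`, the machine `M` becomes `T`. -/
def LoopsTo (M : SequentialMachine Bool (Fin 3) (Fin 3)) (T : PartialMachine Bool Bool Bool) :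
    Prop :=
  ∀ q x, M.toPartial.run loopWiring.out 3 q (loopWiring.inp x) = T q x

instance (M : SequentialMachine Bool (Fin 3) (Fin 3)) (T : PartialMachine Bool Bool Bool) :
    Decidable (M.LoopsTo T) :=
  inferInstanceAs (Decidable (∀ _, _))

theorem LoopsTo.simulates {M : SequentialMachine Bool (Fin 3) (Fin 3)}
    {T : PartialMachine Bool Bool Bool} (h : M.LoopsTo T) : M.toPartial.Simulates T :=
  .of_run loopWiring id 3 injective_id fun q x _ ht => (h q x).trans ht

set_option maxRecDepth 100000 in
/-- If the input `0` in the state `false` changes the state and leads to the output `0`, an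
essential machine is one of `120` candidates.  After renaming the ports, each of those becomes the
reading toggle by a feedback line or is one of three exceptions. -/
theorem exists_relabel_readToggle : ∀ t ∈ [0, 1, 2, 4, 5].permutations',
    (∀ s, ((ofCode (3 :: t)).move false s).1 = false → ((ofCode (3 :: t)).move true s).1 = true →
      ((ofCode (3 :: t)).move false s).2 ≠ ((ofCode (3 :: t)).move true s).2) →
    (∃ s, ((ofCode (3 :: t)).move false s).2 ≠ ((ofCode (3 :: t)).move true s).2) →
    ∃ σ ∈ permutationsThree, ∃ τ ∈ permutationsThree,
      ((ofCode (3 :: t)).relabel false σ τ).LoopsTo readToggle ∨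
      ((ofCode (3 :: t)).relabel false σ τ).code ∈
        [[0, 1, 5, 2, 3, 4], [0, 4, 5, 1, 3, 2], [3, 4, 5, 1, 2, 0]] := by
  decide +kernel

set_option maxRecDepth 100000 in
/-- The analogue of `exists_relabel_readToggle` for the inverse of the reading toggle; up to
renaming, its three exceptions are the inverses of the exceptions there. -/
theorem exists_relabel_writeCompare : ∀ t ∈ [0, 1, 2, 4, 5].permutations',
    (∀ s, ((ofCode (3 :: t)).move false s).1 = false → ((ofCode (3 :: t)).move true s).1 = true →
      ((ofCode (3 :: t)).move false s).2 ≠ ((ofCode (3 :: t)).move true s).2) →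
    (∃ s, ((ofCode (3 :: t)).move false s).2 ≠ ((ofCode (3 :: t)).move true s).2) →
    ∃ σ ∈ permutationsThree, ∃ τ ∈ permutationsThree,
      ((ofCode (3 :: t)).relabel false σ τ).LoopsTo writeCompare ∨
      ((ofCode (3 :: t)).relabel false σ τ).code ∈
        [[0, 1, 3, 4, 5, 2], [0, 3, 4, 5, 2, 1], [3, 4, 5, 1, 2, 0]] := by
  decide +kernel

/-- The exceptional machines yield the reading toggle with two or three copies. -/
theorem canBuild_readToggle_of_mem {M : SequentialMachine Bool (Fin 3) (Fin 3)}
    (h : M.code ∈ [[0, 1, 5, 2, 3, 4], [0, 4, 5, 1, 3, 2], [3, 4, 5, 1, 2, 0]]) :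
    M.CanBuild readToggle := by
  rw [← ofCode_code M]
  simp only [List.mem_cons, List.not_mem_nil, or_false] at h
  rcases h with h | h | h <;> rw [h]
  · exact ⟨2, .of_run
      { inp := fun x => bif x then (1, 2) else (0, 1)
        out := fun x => ![
          ![some (.inl true), some (.inr (1, 1)), some (.inr (1, 0))],
          ![some (.inr (0, 0)), some (.inl false), some (.inr (0, 2))]] x.1 x.2
        inp_injective := by decide
        out_injective := by decide
        out_ne_inp := by decide }
      (fun q => ![q, false]) 16 (by decide) (by decide)⟩
  · exact ⟨2, .of_run
      { inp := fun x => bif x then (0, 1) else (0, 0)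
        out := fun x => ![
          ![some (.inr (1, 0)), some (.inr (1, 2)), some (.inl true)],
          ![some (.inl false), some (.inr (0, 2)), some (.inr (1, 1))]] x.1 x.2
        inp_injective := by decide
        out_injective := by decide
        out_ne_inp := by decide }
      (fun q => ![q, q]) 8 (by decide) (by decide)⟩
  · exact ⟨3, .of_run
      { inp := fun x => bif x then (0, 1) else (0, 0)
        out := fun x => ![
          ![some (.inr (1, 0)), some (.inr (2, 0)), some (.inr (2, 1))],
          ![some (.inr (0, 2)), some (.inl false), some (.inl true)],
          ![some (.inr (1, 1)), some (.inr (1, 2)), some (.inr (2, 2))]] x.1 x.2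
        inp_injective := by decide
        out_injective := by decide +kernel
        out_ne_inp := by decide }
      (fun q => ![q, q, q]) 20 (by decide) (by decide +kernel)⟩

/-- The exceptional machines yield the inverse reading toggle with two or three copies. -/
theorem canBuild_writeCompare_of_mem {M : SequentialMachine Bool (Fin 3) (Fin 3)}
    (h : M.code ∈ [[0, 1, 3, 4, 5, 2], [0, 3, 4, 5, 2, 1], [3, 4, 5, 1, 2, 0]]) :
    M.CanBuild writeCompare := by
  rw [← ofCode_code M]
  simp only [List.mem_cons, List.not_mem_nil, or_false] at h
  rcases h with h | h | h <;> rw [h]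
  · exact ⟨2, .of_run
      { inp := fun x => bif x then (1, 0) else (0, 1)
        out := fun x => ![
          ![some (.inr (1, 2)), some (.inr (1, 1)), some (.inl true)],
          ![some (.inr (0, 0)), some (.inl false), some (.inr (0, 2))]] x.1 x.2
        inp_injective := by decide
        out_injective := by decide
        out_ne_inp := by decide }
      (fun q => ![false, q]) 16 (by decide) (by decide)⟩
  · exact ⟨2, .of_run
      { inp := fun x => bif x then (1, 2) else (0, 0)
        out := fun x => ![
          ![some (.inr (1, 0)), some (.inr (1, 1)), some (.inr (0, 2))],
          ![some (.inl false), some (.inr (0, 1)), some (.inl true)]] x.1 x.2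
        inp_injective := by decide
        out_injective := by decide
        out_ne_inp := by decide }
      (fun q => ![q, q]) 8 (by decide) (by decide)⟩
  · exact ⟨3, .of_run
      { inp := fun x => bif x then (0, 1) else (0, 0)
        out := fun x => ![
          ![some (.inr (1, 0)), some (.inr (2, 0)), some (.inr (2, 1))],
          ![some (.inr (0, 2)), some (.inl false), some (.inl true)],
          ![some (.inr (1, 2)), some (.inr (1, 1)), some (.inr (2, 2))]] x.1 x.2
        inp_injective := by decide
        out_injective := by decide +kernel
        out_ne_inp := by decide }
      (fun q => ![q, q, q]) 20 (by decide) (by decide +kernel)⟩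

theorem LoopsTo.canBuild {M : SequentialMachine Bool (Fin 3) (Fin 3)}
    {T : PartialMachine Bool Bool Bool} (h : M.LoopsTo T) : M.CanBuild T :=
  (CanBuild.refl M).trans h.simulates

/-- An essential machine with three symbols yields the reading toggle and its inverse. -/
theorem IsEssential.canBuild_of_three {S G : Type*} {M : SequentialMachine Bool S G}
    (h : M.IsEssential) (hM : M.IsReversible) (hS : Nat.card S = 3) (hG : Nat.card G = 3) :
    ∃ N : SequentialMachine Bool (Fin 3) (Fin 3), M.toPartial.Simulates N.toPartial ∧
      N.CanBuild readToggle ∧ N.CanBuild writeCompare := by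
  obtain ⟨q₀, s₀, h₀⟩ := h.exists_toggle
  have : Finite S := Nat.finite_of_card_ne_zero (by lia)
  have : Finite G := Nat.finite_of_card_ne_zero (by lia)
  let eS : S ≃ Fin 3 := Finite.equivFinOfCardEq hS
  let eG : G ≃ Fin 3 := Finite.equivFinOfCardEq hG
  -- name the ports so that in the state `false` the input `0` leads to the output `0`
  -- and changes the state
  let σ : Fin 3 ≃ S := (Equiv.swap 0 (eS s₀)).trans eS.symm
  let τ : G ≃ Fin 3 := eG.trans (Equiv.swap (eG (M.move q₀ s₀).2) 0)
  let N := M.relabel q₀ σ τ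
  have hN : N.IsReversible := hM.relabel q₀ σ.injective τ.injective
  have hess : N.IsEssential := h.relabel q₀ σ τ.injective
  have hσ : σ 0 = s₀ := by simp [σ]
  have hN₀ : N.move false 0 = (true, 0) := by
    change ((M.move (false ^^ q₀) (σ 0)).1 ^^ q₀, τ (M.move (false ^^ q₀) (σ 0)).2) = _
    rw [hσ, Bool.false_xor, h₀]
    simp [τ]
  obtain ⟨t, ht⟩ : ∃ t, N.code = 3 :: t :=
    ⟨_, List.cons_eq_cons.2 ⟨by simp [hN₀], rfl⟩⟩
  have htp : t ∈ [0, 1, 2, 4, 5].permutations' := by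
    rw [List.mem_permutations']
    exact (List.perm_cons 3).1 (ht ▸ code_perm hN)
  have hNt : ofCode (3 :: t) = N := by rw [← ht, ofCode_code]
  have build : ∀ {T : PartialMachine Bool Bool Bool} {σ τ}, σ ∈ permutationsThree →
      τ ∈ permutationsThree → (N.relabel false σ τ).CanBuild T → N.CanBuild T :=
    fun hσ hτ => .of_simulates (simulates_relabel N false
      (injective_of_mem_permutationsThree _ hσ) (injective_of_mem_permutationsThree _ hτ))
  refine ⟨N, simulates_relabel M q₀ σ.injective τ.injective, ?_, ?_⟩
  · obtain ⟨σ, hσ, τ, hτ, h | h⟩ := exists_relabel_readToggle t htp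
      (by rw [hNt]; exact hess.no_wire) (by rw [hNt]; exact hess.exists_split) <;> rw [hNt] at h
    · exact build hσ hτ h.canBuild
    · exact build hσ hτ (canBuild_readToggle_of_mem h)
  · obtain ⟨σ, hσ, τ, hτ, h | h⟩ := exists_relabel_writeCompare t htp
      (by rw [hNt]; exact hess.no_wire) (by rw [hNt]; exact hess.exists_split) <;> rw [hNt] at h
    · exact build hσ hτ h.canBuild
    · exact build hσ hτ (canBuild_writeCompare_of_mem h)

end SequentialMachine

namespace SequentialMachine

/-! ### Non-degenerate machines are essential -/

/-- If the output depends on the input symbol only, as long as the state stays in an invariant set,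
then words are transformed symbol by symbol. -/
theorem outputs_eq_map {Q S G : Type*} {M : SequentialMachine Q S G} {f : S → G} {R : Q → Prop}
    (hR : ∀ q a, R q → R (M.move q a).1 ∧ (M.move q a).2 = f a) (w : List S) :
    ∀ q, R q → M.outputs q w = w.map f := by
  induction w with
  | nil => exact fun q _ => rfl
  | cons a w ih =>
    intro q hq
    rw [outputs, List.map_cons, (hR q a hq).2, ih _ (hR q a hq).1]

/-- A machine with a plain wire is equivalent to a machine with one symbol less, supplemented
with this wire. -/
theorem IsRLEM.isDegenerate_of_wire {Q S G : Type*} {M : SequentialMachine Q S G} {n k : ℕ}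
    (hM : M.IsRLEM n k) {s : S} {g : G} (hw : ∀ q, M.move q s = (q, g)) [Nonempty Q] :
    M.IsDegenerate n k := by
  classical
  have := hM.finite_states
  have := hM.finite_inputs
  have := hM.finite_outputs
  obtain ⟨q₀⟩ := ‹Nonempty Q›
  obtain ⟨k, rfl⟩ : ∃ j, k = j + 1 := by
    have : 0 < Nat.card S := Nat.card_pos_iff.2 ⟨⟨s⟩, inferInstance⟩
    exact ⟨k - 1, by rw [hM.card_inputs] at this; lia⟩
  have hS : Nat.card {t : S // t ≠ s} = k := by
    have := hM.card_inputs
    rw [← Nat.card_congr (Equiv.optionSubtypeNe s), Finite.card_option] at this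
    lia
  have hG : Nat.card {x : G // x ≠ g} = k := by
    have := hM.card_outputs
    rw [← Nat.card_congr (Equiv.optionSubtypeNe g), Finite.card_option] at this
    lia
  let eQ : Q ≃ Fin n := Finite.equivFinOfCardEq hM.card_states
  let eS : {t : S // t ≠ s} ≃ Fin k := Finite.equivFinOfCardEq hS
  let eG : {x : G // x ≠ g} ≃ Fin k := Finite.equivFinOfCardEq hG
  let u : PUnit.{1} ≃ Fin (k + 1 - k) := Finite.equivFinOfCardEq (by simp)
  let eS' : S ≃ Fin k ⊕ Fin (k + 1 - k) := (Equiv.optionSubtypeNe s).symm.trans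
    ((Equiv.optionEquivSumPUnit _).trans (Equiv.sumCongr eS u))
  let eG' : G ≃ Fin k ⊕ Fin (k + 1 - k) := (Equiv.optionSubtypeNe g).symm.trans
    ((Equiv.optionEquivSumPUnit _).trans (Equiv.sumCongr eG u))
  have hS's : eS' s = .inr (u ⟨⟩) := by simp [eS']
  have hG'g : eG' g = .inr (u ⟨⟩) := by simp [eG']
  have hS' : ∀ t (ht : t ≠ s), eS' t = .inl (eS ⟨t, ht⟩) := fun t ht => by
    simp [eS', Equiv.optionSubtypeNe_symm_of_ne ht]
  have hG' : ∀ x (hx : x ≠ g), eG' x = .inl (eG ⟨x, hx⟩) := fun x hx => by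
    simp [eG', Equiv.optionSubtypeNe_symm_of_ne hx]
  have hne : ∀ q (t : {t : S // t ≠ s}), (M.move q t).2 ≠ g := fun q t e =>
    t.2 (hM.reversible.eq_of_move_eq
      ((Prod.ext rfl e : M.move q t = ((M.move q t).1, g)).trans (hw _).symm)).2
  let N : SequentialMachine (Fin n) (Fin k) (Fin k) :=
    ⟨fun q a => (eQ (M.move (eQ.symm q) (eS.symm a)).1, eG ⟨_, hne (eQ.symm q) (eS.symm a)⟩)⟩
  have hN : N.IsReversible := by
    rintro ⟨q, a⟩ ⟨q', a'⟩ h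
    simp only [N, Prod.mk.injEq, EmbeddingLike.apply_eq_iff_eq, Subtype.mk.injEq] at h
    have := hM.reversible.eq_of_move_eq (Prod.ext h.1 h.2)
    exact Prod.ext (eQ.symm.injective this.1) (eS.symm.injective (Subtype.ext this.2))
  refine .inr ⟨k, k.lt_succ_self, N, ⟨inferInstance, inferInstance, inferInstance, by simp,
    by simp, by simp, hN⟩, eQ, eS', eG', fun q a => ?_⟩
  by_cases ha : a = s
  · subst ha
    simp only [hS's, hw, hG'g, withWires]
  · simp only [hS' a ha, hG' _ (hne q ⟨a, ha⟩), withWires, N, Equiv.symm_apply_apply]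

theorem IsRLEM.isEssential_of_not_isDegenerate {Q S G : Type*} {M : SequentialMachine Q S G}
    {n k : ℕ} (hM : M.IsRLEM n k) (h : ¬ M.IsDegenerate n k) (e : Q ≃ Bool) :
    IsEssential ⟨fun q s => (e (M.move (e.symm q) s).1, (M.move (e.symm q) s).2)⟩ := by
  have : Nonempty Q := ⟨e.symm false⟩
  refine ⟨fun t h₁ h₂ h₃ => h (hM.isDegenerate_of_wire (s := t)
    (g := (M.move (e.symm false) t).2) fun q => ?_), ?_, ?_⟩
  · obtain ⟨q, rfl⟩ := e.symm.surjective q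
    cases q
    · exact Prod.ext (e.eq_symm_apply.2 h₁) rfl
    · exact Prod.ext (e.eq_symm_apply.2 h₂) h₃.symm
  · -- the state never changes
    by_contra! hc
    refine h (.inl fun q => ⟨fun a => (M.move q a).2, fun w =>
      outputs_eq_map (R := (· = q)) ?_ w q rfl⟩)
    rintro _ a rfl
    refine ⟨?_, rfl⟩
    rename_i q
    have := hc (e q) a
    simp only [Equiv.symm_apply_apply] at this
    exact e.injective (by simpa using Bool.eq_not.2 this)
  · -- the state has no influence on the output
    by_contra! hc
    refine h (.inl fun q => ⟨fun a => (M.move (e.symm false) a).2, fun w =>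
      outputs_eq_map (R := fun _ => True) ?_ w q trivial⟩)
    intro q a _
    obtain ⟨q, rfl⟩ := e.symm.surjective q
    cases q
    · exact ⟨trivial, rfl⟩
    · exact ⟨trivial, (hc a).symm⟩

end SequentialMachine

/-! ### Universality -/

theorem theorem2 {Q S G : Type*} (M : SequentialMachine Q S G) (k : ℕ) (hk : 2 < k)
    (hM : M.IsRLEM 2 k) (hnd : ¬ M.IsDegenerate 2 k) : M.IsUniversal := by
  intro P A B _ _ _ _ N hN
  have := hM.finite_states
  have := hM.finite_inputs
  have := hM.finite_outputs
  obtain ⟨e⟩ : Nonempty (Q ≃ Bool) := Finite.card_eq.1 (by simp [hM.card_states])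
  have hess := hM.isEssential_of_not_isDegenerate hnd e
  set M₁ : SequentialMachine Bool S G :=
    ⟨fun q s => (e (M.move (e.symm q) s).1, (M.move (e.symm q) s).2)⟩ with hM₁
  have hrev : M₁.IsReversible := by
    rintro ⟨q, s⟩ ⟨q', s'⟩ h
    simp only [hM₁, Prod.mk.injEq, EmbeddingLike.apply_eq_iff_eq] at h
    have := hM.reversible.eq_of_move_eq (Prod.ext h.1 h.2)
    exact Prod.ext (e.symm.injective this.1) this.2
  have hMM₁ : M.toPartial.Simulates M₁.toPartial :=
    .of_run ⟨id, fun x => some (.inl x), injective_id,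
        fun _ _ _ hx hy => Sum.inl_injective (Option.some_injective _ (hx.trans hy.symm)),
        by simp⟩ e.symm 1 e.symm.injective (by
      rintro q s _ ⟨⟩
      simp [run, SequentialMachine.toPartial, hM₁])
  obtain ⟨S', G', M₂, hess₂, hrev₂, hS', hG', h₁₂⟩ := hess.exists_three (k - 3) hrev
    (by rw [hM.card_inputs]; lia) (by rw [hM.card_outputs]; lia)
  obtain ⟨M₃, h₂₃, hR, hW⟩ := hess₂.canBuild_of_three hrev₂ hS' hG'
  have h := (hMM₁.trans h₁₂).trans h₂₃
  have hAB : Nat.card A ≤ Nat.card B := by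
    have := Nat.card_le_card_of_injective _ hN
    rw [Nat.card_prod, Nat.card_prod] at this
    exact Nat.le_of_mul_le_mul_left this Nat.card_pos
  obtain ⟨f⟩ : Nonempty (A ↪ B) := by
    have := Fintype.ofFinite A
    have := Fintype.ofFinite B
    exact Embedding.nonempty_of_card_le (by simpa [Nat.card_eq_fintype_card] using hAB)
  exact (SequentialMachine.CanBuild.of_isReversible (.of_simulates h hR) (.of_simulates h hW)
    N hN f).exists_realizes (by rw [hM.card_inputs, hM.card_outputs]) hAB
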